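/- Let $m$ be a square-free positive integer and let $F = \mathbb{Q}(\sqrt{-m}) \subseteq \mathbb{C}$. Then: (1) there exist $r, s \in F$ with $r^2 + s^2 = -1$ and $rs(r^2 - s^2) \neq 0$ if and only if $m \not\equiv 7 \pmod 8$; (2) there exist $t, u \in F$ with $t^2 + u^2 = -2$ and $tu(t^2 - u^2) \neq 0$ if and only if $m \not\equiv 7 \pmod 8$. -/

import Mathlib

/-- The imaginary quadratic field `ℚ(√(-m))`, as the subfield of `ℂ` generated over `ℚ` by
`√(-m) = i √m`. -/
noncomputable def imagQuadField (m : ℕ) : IntermediateField ℚ ℂ :=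
  IntermediateField.adjoin ℚ {Complex.I * ((Real.sqrt (m : ℝ) : ℝ) : ℂ)}

/-- The chosen generator is indeed a square root of `-m`. -/
theorem imagQuadField_gen_sq (m : ℕ) :
    (Complex.I * ((Real.sqrt (m : ℝ) : ℝ) : ℂ)) ^ 2 = -(m : ℂ) := by
  have h : (((Real.sqrt (m : ℝ) : ℝ) : ℂ)) ^ 2 = (m : ℂ) := by
    rw [← Complex.ofReal_pow, Real.sq_sqrt (Nat.cast_nonneg m), Complex.ofReal_natCast]
  rw [mul_pow, Complex.I_sq, h]
  ring

/-! Let w² = -m. Splitting r = a + bw, s = c + dw into real and imaginary parts turns r² + s² = -1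
into a nontrivial rational solution of mB² = x² + y² + z². Descent modulo 8 excludes this for m ≡ 7.
Otherwise Dirichlet's theorem and quadratic reciprocity supply a nonsquare N = a² + b² with N ≡ -1
mod m and m a square mod N. A pigeonhole argument then solves mT² = X² + NW² with T ≠ 0, that is X²
+ (Tw)² = -NW², and dividing by the sum of two squares N makes -1 a sum of two squares in F. The
nonvanishing conditions cost only a rational rotation, and -2 reduces to -1. -/

/-! ### The form mT² = X² + NW² -/

/-- A case of Legendre's theorem on ternary quadratic forms, proved by the pigeonhole principle. -/
theorem exists_mul_sq_eq_sq_add_mul_sq (m N : ℕ) (hm : 0 < m) (hN : 0 < N)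
    (hsq : ¬ IsSquare N) (hcop : Nat.Coprime m N) (c d : ℤ)
    (hc : (N : ℤ) ∣ c ^ 2 - m) (hd : (m : ℤ) ∣ d ^ 2 + N) :
    ∃ T X W : ℤ, T ≠ 0 ∧ (m : ℤ) * T ^ 2 = X ^ 2 + N * W ^ 2 := by
  have : NeZero m := ⟨hm.ne'⟩
  have : NeZero N := ⟨hN.ne'⟩
  -- The box has more than mN points, so two collide; their difference (x, t, w) has x ≡ dw mod m
  -- and x ≡ ct mod N, whence mN ∣ x² + Nw² - mt².
  let f : Fin ((m * N).sqrt + 1) × Fin (N.sqrt + 1) × Fin (m.sqrt + 1) → ZMod m × ZMod N :=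
    fun v => (((v.1 : ℤ) - d * (v.2.2 : ℤ) : ℤ), ((v.1 : ℤ) - c * (v.2.1 : ℤ) : ℤ))
  have hcard : Fintype.card (ZMod m × ZMod N) <
      Fintype.card (Fin ((m * N).sqrt + 1) × Fin (N.sqrt + 1) × Fin (m.sqrt + 1)) := by
    simp only [Fintype.card_prod, ZMod.card, Fintype.card_fin]
    have h1 := Nat.lt_succ_sqrt' (m * N)
    have h2 := Nat.lt_succ_sqrt' N
    have h3 := Nat.lt_succ_sqrt' m
    simp only [Nat.succ_eq_add_one] at h1 h2 h3
    refine lt_of_pow_lt_pow_left₀ 2 (Nat.zero_le _) ?_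
    calc (m * N) ^ 2 = (m * N) * (N * m) := by ring
      _ < ((m * N).sqrt + 1) ^ 2 * ((N.sqrt + 1) ^ 2 * (m.sqrt + 1) ^ 2) :=
        Nat.mul_lt_mul'' h1 (Nat.mul_lt_mul'' h2 h3)
      _ = _ := by ring
  obtain ⟨⟨x₁, t₁, w₁⟩, ⟨x₂, t₂, w₂⟩, hne, heq⟩ := Fintype.exists_ne_map_eq_of_card_lt f hcard
  have hbound : ∀ (k : ℕ) (a b : Fin (k.sqrt + 1)), ((a : ℤ) - (b : ℤ)) ^ 2 ≤ k := by
    intro k a b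
    have ha : ((a : ℕ) : ℤ) ≤ (k.sqrt : ℤ) := by exact_mod_cast Nat.lt_succ_iff.mp a.2
    have hb : ((b : ℕ) : ℤ) ≤ (k.sqrt : ℤ) := by exact_mod_cast Nat.lt_succ_iff.mp b.2
    have h : (k.sqrt : ℤ) ^ 2 ≤ k := by exact_mod_cast Nat.sqrt_le' k
    refine le_trans ?_ h
    exact sq_le_sq' (by omega) (by omega)
  have hx := hbound _ x₁ x₂
  have ht := hbound _ t₁ t₂
  have hw := hbound _ w₁ w₂
  have hnz : ¬ ((x₁ : ℤ) - x₂ = 0 ∧ (t₁ : ℤ) - t₂ = 0 ∧ (w₁ : ℤ) - w₂ = 0) := by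
    rintro ⟨h1, h2, h3⟩
    apply hne
    ext <;> simp <;> omega
  have h1 := congrArg Prod.fst heq
  have h2 := congrArg Prod.snd heq
  simp only [f] at h1 h2
  rw [ZMod.intCast_eq_intCast_iff_dvd_sub] at h1 h2
  generalize hX : (x₁ : ℤ) - x₂ = x at *
  generalize hT : (t₁ : ℤ) - t₂ = t at *
  generalize hW : (w₁ : ℤ) - w₂ = w at *
  replace h1 : (m : ℤ) ∣ x - d * w := by
    obtain ⟨k, hk⟩ := h1
    exact ⟨-k, by linear_combination d * hW - hX - hk⟩
  replace h2 : (N : ℤ) ∣ x - c * t := by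
    obtain ⟨k, hk⟩ := h2
    exact ⟨-k, by linear_combination c * hT - hX - hk⟩
  clear heq hne f hcard hbound
  push_cast at hx
  have hmN : (m * N : ℤ) ∣ x ^ 2 + N * w ^ 2 - m * t ^ 2 := by
    refine IsCoprime.mul_dvd (Nat.isCoprime_iff_coprime.mpr hcop) ?_ ?_
    · have : x ^ 2 + N * w ^ 2 - m * t ^ 2
          = (x - d * w) * (x + d * w) + (d ^ 2 + N) * w ^ 2 - m * t ^ 2 := by ring
      rw [this]
      exact dvd_sub (dvd_add (h1.mul_right _) (hd.mul_right _)) (dvd_mul_right _ _)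
    · have : x ^ 2 + N * w ^ 2 - m * t ^ 2
          = (x - c * t) * (x + c * t) + (c ^ 2 - m) * t ^ 2 + N * w ^ 2 := by ring
      rw [this]
      exact dvd_add (dvd_add (h2.mul_right _) (hc.mul_right _)) (dvd_mul_right _ _)
  obtain ⟨k, hk⟩ := hmN
  have hmZ : (0 : ℤ) < m := by exact_mod_cast hm
  have hNZ : (0 : ℤ) < N := by exact_mod_cast hN
  have hsqZ : ∀ y : ℤ, y ^ 2 ≠ N := fun y hy => hsq ⟨y.natAbs, by
    have := congrArg Int.natAbs hy
    rw [Int.natAbs_pow, Int.natAbs_natCast] at this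
    rw [← this, sq]⟩
  have ht' : t ^ 2 < N := lt_of_le_of_ne ht (hsqZ t)
  have hpos : (0 : ℤ) < m * N := mul_pos hmZ hNZ
  have hmt : (m : ℤ) * t ^ 2 < m * N := mul_lt_mul_of_pos_left ht' hmZ
  have hNw : (N : ℤ) * w ^ 2 ≤ m * N := by
    rw [mul_comm (m : ℤ)]; exact mul_le_mul_of_nonneg_left hw hNZ.le
  -- The quotient k is 0 or 1: the bounds place mNk above -mN and at most 2mN, and equality at 2mN
  -- would make N a square.
  have hk0 : 0 ≤ k := by
    by_contra! h
    nlinarith [sq_nonneg x, mul_nonneg hNZ.le (sq_nonneg w)]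
  have hk2 : k < 2 := by
    by_contra! h
    have hge : 2 * (m * N : ℤ) ≤ m * N * k := by nlinarith
    have hmt0 : 0 ≤ (m : ℤ) * t ^ 2 := by positivity
    have hxe : x ^ 2 = m * N := by linarith
    have hwe : (N : ℤ) * w ^ 2 = N * m := by linarith
    replace hwe := mul_left_cancel₀ hNZ.ne' hwe
    rw [← hwe] at hxe
    obtain ⟨y, rfl⟩ : w ∣ x := (Int.pow_dvd_pow_iff two_ne_zero).mp ⟨_, hxe⟩
    refine hsqZ y (mul_left_cancel₀ (a := w ^ 2) (by rw [hwe]; exact hmZ.ne') ?_)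
    rw [← hxe]; ring
  obtain rfl | rfl : k = 0 ∨ k = 1 := by omega
  · refine ⟨t, x, w, ?_, by linarith⟩
    rintro rfl
    have hw0 : w = 0 := by
      by_contra h
      have : 0 < (N : ℤ) * w ^ 2 := by positivity
      nlinarith [sq_nonneg x]
    subst hw0
    have hx0 : x = 0 := by
      have : x ^ 2 = 0 := by linarith
      exact pow_eq_zero_iff two_ne_zero |>.mp this
    exact hnz ⟨hx0, rfl, rfl⟩
  · by_cases hwm : w ^ 2 = m
    · exact ⟨1, w, 0, one_ne_zero, by rw [hwm]; ring⟩
    -- For k = 1, x² - mt² = -N(w² - m). The identity takes norms in (x + t√m)(w + √m) = (xw + mt) +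
    -- (x + tw)√m.
    · have key : (m : ℤ) * (x + t * w) ^ 2 = (x * w + m * t) ^ 2 + N * (w ^ 2 - m) ^ 2 := by
        linear_combination (m - w ^ 2 : ℤ) * hk
      refine ⟨x + t * w, x * w + m * t, w ^ 2 - m, ?_, key⟩
      intro h0
      rw [h0] at key
      have : 0 < (N : ℤ) * (w ^ 2 - m) ^ 2 := by
        have := sub_ne_zero.mpr hwm
        positivity
      nlinarith [sq_nonneg (x * w + m * t)]

/-! ### Nondegeneracy -/

/-- Rotation by (3 + 4i)/5 preserves r² + s². Since 4rs(r² - s²) is formally the imaginary part of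
(r + is)⁴, a degenerate value 0 becomes ±84/625. -/
theorem exists_nondegenerate_of_sq_add_sq_eq_neg_one {K : Type*} [Field K] [CharZero K]
    (h : ∃ r s : K, r ^ 2 + s ^ 2 = -1) :
    ∃ r s : K, r ^ 2 + s ^ 2 = -1 ∧ r * s * (r ^ 2 - s ^ 2) ≠ 0 := by
  obtain ⟨r, s, h⟩ := h
  by_cases h0 : r * s * (r ^ 2 - s ^ 2) = 0
  · refine ⟨(3 * r - 4 * s) / 5, (4 * r + 3 * s) / 5, ?_, ?_⟩
    · linear_combination h
    · have hne : r ≠ 0 ∨ s ≠ 0 := by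
        by_contra! hh
        simp [hh.1, hh.2] at h
      have e : (3 * r - 4 * s) / 5 * ((4 * r + 3 * s) / 5) *
          (((3 * r - 4 * s) / 5) ^ 2 - ((4 * r + 3 * s) / 5) ^ 2) =
          (- 84 * (r ^ 2 + s ^ 2) ^ 2 + 672 * r ^ 2 * s ^ 2 - 527 * (r * s * (r ^ 2 - s ^ 2))) / 625 := by
        ring
      rw [e, h0, h]
      rcases mul_eq_zero.mp h0 with h1 | h1
      · have : r ^ 2 * s ^ 2 = 0 := by rw [← mul_pow, h1]; simp
        rw [mul_assoc, this]; norm_num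
      · have h2 : r ^ 2 = -1 / 2 := by linear_combination (h + h1) / 2
        have h3 : s ^ 2 = -1 / 2 := by linear_combination (h - h1) / 2
        rw [h2, h3]; norm_num
  · exact ⟨r, s, h, h0⟩

theorem nondegenerate_sq_add_sq_eq_neg_two_iff {K : Type*} [Field K] [CharZero K] :
    (∃ t u : K, t ^ 2 + u ^ 2 = -2 ∧ t * u * (t ^ 2 - u ^ 2) ≠ 0) ↔
      ∃ r s : K, r ^ 2 + s ^ 2 = -1 ∧ r * s * (r ^ 2 - s ^ 2) ≠ 0 := by
  constructor
  · rintro ⟨t, u, h, h0⟩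
    refine ⟨(t + u) / 2, (t - u) / 2, by linear_combination h / 2, ?_⟩
    have : (t + u) / 2 * ((t - u) / 2) * (((t + u) / 2) ^ 2 - ((t - u) / 2) ^ 2) =
      t * u * (t ^ 2 - u ^ 2) / 4 := by ring
    rw [this]
    exact div_ne_zero h0 (by norm_num)
  · rintro ⟨r, s, h, h0⟩
    refine ⟨r + s, r - s, by linear_combination 2 * h, ?_⟩
    have : (r + s) * (r - s) * ((r + s) ^ 2 - (r - s) ^ 2) = 4 * (r * s * (r ^ 2 - s ^ 2)) := by ring
    rw [this]
    exact mul_ne_zero (by norm_num) h0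

/-! ### The obstruction modulo 8 -/

/-- Modulo 8 the equation reads T² + x² + y² + z² ≡ 0, which forces all four to be even; halving
gives an infinite descent. -/
theorem eq_zero_of_mul_sq_eq_three_squares {m : ℕ} (hm : m ≡ 7 [MOD 8]) {T x y z : ℤ}
    (h : (m : ℤ) * T ^ 2 = x ^ 2 + y ^ 2 + z ^ 2) : T = 0 := by
  have hm8 : (m : ZMod 8) = 7 := (ZMod.natCast_eq_natCast_iff _ _ _).mpr hm
  induction hn : T.natAbs using Nat.strong_induction_on generalizing T x y z with
  | _ n ih =>
  by_contra hT
  have h8 : (7 : ZMod 8) * (T : ZMod 8) ^ 2 = (x : ZMod 8) ^ 2 + (y : ZMod 8) ^ 2 + (z : ZMod 8) ^ 2 := by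
    rw [← hm8]
    exact_mod_cast congrArg (Int.cast : ℤ → ZMod 8) h
  have key : ∀ T x y z : ZMod 8, 7 * T ^ 2 = x ^ 2 + y ^ 2 + z ^ 2 →
      4 * T = 0 ∧ 4 * x = 0 ∧ 4 * y = 0 ∧ 4 * z = 0 := by decide +kernel
  have even : ∀ a : ℤ, 4 * (a : ZMod 8) = 0 → ∃ b, a = 2 * b := by
    intro a ha
    have : ((4 * a : ℤ) : ZMod 8) = 0 := by push_cast; exact ha
    rw [ZMod.intCast_zmod_eq_zero_iff_dvd] at this
    exact ⟨a / 2, by omega⟩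
  obtain ⟨hT2, hx, hy, hz⟩ := key _ _ _ _ h8
  obtain ⟨T, rfl⟩ := even _ hT2
  obtain ⟨x, rfl⟩ := even _ hx
  obtain ⟨y, rfl⟩ := even _ hy
  obtain ⟨z, rfl⟩ := even _ hz
  have : T = 0 := ih T.natAbs (by omega) (T := T) (x := x) (y := y) (z := z)
    (by linarith) rfl
  omega

theorem eq_zero_of_mul_rat_sq_eq_three_squares {m : ℕ} (hm : m ≡ 7 [MOD 8]) (B x y z : ℚ)
    (h : (m : ℚ) * B ^ 2 = x ^ 2 + y ^ 2 + z ^ 2) : B = 0 := by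
  have hclear : ∀ q e : ℚ, ∀ k : ℤ, e = q.den * k → q * e = ((q.num * k : ℤ) : ℚ) := by
    rintro q e k rfl
    rw [← mul_assoc, Rat.mul_den_eq_num]; push_cast; rfl
  let D : ℚ := B.den * x.den * y.den * z.den
  have hB := hclear B D (x.den * y.den * z.den) (by simp only [D]; push_cast; ring)
  have hx := hclear x D (B.den * y.den * z.den) (by simp only [D]; push_cast; ring)
  have hy := hclear y D (B.den * x.den * z.den) (by simp only [D]; push_cast; ring)
  have hz := hclear z D (B.den * x.den * y.den) (by simp only [D]; push_cast; ring)
  have h0 := eq_zero_of_mul_sq_eq_three_squares hm (T := B.num * (x.den * y.den * z.den))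
    (x := x.num * (B.den * y.den * z.den)) (y := y.num * (B.den * x.den * z.den))
    (z := z.num * (B.den * x.den * y.den)) (by
      have : (m : ℚ) * (B * D) ^ 2 = (x * D) ^ 2 + (y * D) ^ 2 + (z * D) ^ 2 := by
        linear_combination D ^ 2 * h
      rw [hB, hx, hy, hz] at this
      exact_mod_cast this)
  simpa using h0

/-! ### Choosing N by Dirichlet and reciprocity -/

theorem exists_prime_modEq_and_modEq {M k e a : ℕ} (hM : M ≠ 0) (hk : k ≠ 0)
    (hMk : Nat.Coprime M k) (he : Nat.Coprime e M) (ha : Nat.Coprime a k) (n : ℕ) :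
    ∃ p > n, p.Prime ∧ p ≡ e [MOD M] ∧ p ≡ a [MOD k] := by
  obtain ⟨x, hxM, hxk⟩ := Nat.chineseRemainder hMk e a
  have hx : Nat.Coprime x (M * k) :=
    Nat.Coprime.mul_right (hxM.gcd_eq.trans he) (hxk.gcd_eq.trans ha)
  obtain ⟨p, hp, hpp, hpx⟩ := Nat.forall_exists_prime_gt_and_modEq n (mul_ne_zero hM hk) hx
  exact ⟨p, hp, hpp, (hpx.of_mul_right k).trans hxM, (hpx.of_mul_left M).trans hxk⟩

theorem exists_dvd_sq_sub_of_jacobiSym_eq_one {p : ℕ} (hp : p.Prime) {a : ℤ}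
    (h : jacobiSym a p = 1) : ∃ c : ℤ, (p : ℤ) ∣ c ^ 2 - a := by
  have : Fact p.Prime := ⟨hp⟩
  obtain ⟨y, hy⟩ := ZMod.isSquare_of_jacobiSym_eq_one h
  obtain ⟨c, rfl⟩ := ZMod.intCast_surjective y
  refine ⟨c, (ZMod.intCast_zmod_eq_zero_iff_dvd _ _).mp ?_⟩
  push_cast
  rw [hy]; ring

/-- N is p or 2p with p ≡ 1 mod 4 prime. If m ≡ 1 mod 4, take p ≡ -1 mod m: (m/p) = (p/m) = (-1/m) =
1. If m ≡ 3 mod 8, (-1/m) = -1, so take 2p ≡ -1 mod m and use (p/m) = (-2/m) = 1. If m = 2k, take p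
≡ -1 mod k and fix p mod 8 so that (2/p) = (-1/k). -/
theorem exists_sum_two_squares_and_residues {m : ℕ} (hm4 : ¬ 4 ∣ m) (hm7 : m % 8 ≠ 7) :
    ∃ N a b : ℕ, 0 < N ∧ N = a ^ 2 + b ^ 2 ∧ ¬ IsSquare N ∧ m ∣ N + 1 ∧
      ∃ c : ℤ, (N : ℤ) ∣ c ^ 2 - m := by
  have two_squares : ∀ p : ℕ, p.Prime → p % 4 = 1 → ∃ a b : ℕ, a ^ 2 + b ^ 2 = p := by
    intro p hp h
    have : Fact p.Prime := ⟨hp⟩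
    exact Nat.Prime.sq_add_sq (by omega)
  have dvd_of : ∀ {p k a r : ℕ}, p ≡ a [MOD k] → ∀ s, k ∣ s * a + r → k ∣ s * p + r := by
    intro p k a r h s hd
    exact (((h.mul_left s).add_right r).dvd_iff dvd_rfl).mpr hd
  have cop : ∀ k : ℕ, 0 < k → Nat.Coprime (k - 1) k := fun k hk => by
    obtain ⟨j, rfl⟩ := Nat.exists_eq_succ_of_ne_zero hk.ne'
    simp
  have neg_one_of : ∀ {p k : ℕ}, k ∣ p + 1 → (p : ℤ) ≡ -1 [ZMOD k] := fun {p k} h =>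
    (Int.modEq_iff_dvd.mpr (by
      rw [sub_neg_eq_add]; exact_mod_cast h)).symm
  have cases : m % 4 = 1 ∨ m % 8 = 3 ∨ m % 4 = 2 := by omega
  rcases cases with h | h | h
  · have hodd : Odd m := Nat.odd_iff.mpr (by omega)
    obtain ⟨p, -, hp, hp4, hpm⟩ := exists_prime_modEq_and_modEq (M := 4) (k := m) (e := 1)
      (by norm_num) (by omega) (Nat.Coprime.pow_left 2 (Nat.coprime_two_left.mpr hodd))
      (Nat.coprime_one_left _) (cop m (by omega)) 0
    replace hp4 : p % 4 = 1 := hp4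
    obtain ⟨a, b, hab⟩ := two_squares p hp hp4
    have hdvd : m ∣ p + 1 := by
      simpa using dvd_of (r := 1) hpm 1 (by rw [one_mul, Nat.sub_add_cancel (by omega)])
    refine ⟨p, a, b, hp.pos, hab.symm, hp.prime.irreducible.not_isSquare, hdvd,
      exists_dvd_sq_sub_of_jacobiSym_eq_one hp ?_⟩
    rw [jacobiSym.quadratic_reciprocity_one_mod_four' hodd hp4,
      jacobiSym.mod_left' (a₂ := -1), jacobiSym.at_neg_one hodd, ZMod.χ₄_nat_one_mod_four h]
    exact neg_one_of hdvd
  · have hodd : Odd m := Nat.odd_iff.mpr (by omega)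
    -- (m - 1)/2 represents -1/2 modulo m.
    have hcop : Nat.Coprime ((m - 1) / 2) m := by
      rw [Nat.coprime_iff_gcd_eq_one, ← Nat.dvd_one]
      have h1 := Nat.gcd_dvd_left ((m - 1) / 2) m
      have h2 := Nat.gcd_dvd_right ((m - 1) / 2) m
      have h3 : m = 2 * ((m - 1) / 2) + 1 := by omega
      exact (Nat.dvd_add_right (h1.mul_left 2)).mp (h3 ▸ h2)
    obtain ⟨p, -, hp, hp4, hpm⟩ := exists_prime_modEq_and_modEq (M := 4) (k := m) (e := 1)
      (by norm_num) (by omega) (Nat.Coprime.pow_left 2 (Nat.coprime_two_left.mpr hodd))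
      (Nat.coprime_one_left _) hcop 0
    replace hp4 : p % 4 = 1 := hp4
    obtain ⟨a, b, hab⟩ := two_squares p hp hp4
    have hdvd : m ∣ 2 * p + 1 := dvd_of hpm 2 (by rw [show 2 * ((m - 1) / 2) + 1 = m by omega])
    obtain ⟨u, v, huv⟩ := Nat.sq_add_sq_mul (a := 2) (x := 1) (y := 1) (by norm_num) hab.symm
    refine ⟨2 * p, u, v, by have := hp.pos; omega, huv, ?_, hdvd, ?_⟩
    · rintro ⟨y, hy⟩
      rcases Nat.even_or_odd' y with ⟨z, rfl | rfl⟩ <;> ring_nf at hy <;> omega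
    · have hJ : jacobiSym m p = 1 := by
        rw [jacobiSym.quadratic_reciprocity_one_mod_four' hodd hp4]
        have h1 : jacobiSym (-2 * p) m = 1 := by
          rw [jacobiSym.mod_left' (a₂ := 1), jacobiSym.one_left]
          refine Int.modEq_iff_dvd.mpr ?_
          rw [show (1 : ℤ) - -2 * p = ((2 * p + 1 : ℕ) : ℤ) by push_cast; ring]
          exact_mod_cast hdvd
        have h2 : jacobiSym (-2) m = 1 := by
          rw [jacobiSym.at_neg_two hodd]
          rw [ZMod.χ₈'_nat_eq_if_mod_eight, if_neg (by omega), if_pos (Or.inr h)]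
        rwa [jacobiSym.mul_left, h2, one_mul] at h1
      obtain ⟨c, hc⟩ := exists_dvd_sq_sub_of_jacobiSym_eq_one hp hJ
      have h2p : IsCoprime (2 : ℤ) p := by
        exact_mod_cast Nat.isCoprime_iff_coprime.mpr
          (Nat.coprime_two_left.mpr (Nat.odd_iff.mpr (by omega)))
      have hpar : ∀ x : ℤ, Odd x → (2 : ℤ) ∣ x ^ 2 - m := fun x hx =>
        ((hx.pow).sub_odd (by exact_mod_cast hodd)).two_dvd
      push_cast
      rcases Int.even_or_odd c with hce | hco
      · have hpo : Odd (p : ℤ) := by exact_mod_cast Nat.odd_iff.mpr (by omega)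
        -- Adding the odd p makes the root odd, so that 2 also divides its square minus m.
        refine ⟨c + p, h2p.mul_dvd (hpar _ (hce.add_odd hpo)) ?_⟩
        rw [show (c + p : ℤ) ^ 2 - m = (c ^ 2 - m) + p * (2 * c + p) by ring]
        exact hc.add (dvd_mul_right _ _)
      · exact ⟨c, h2p.mul_dvd (hpar _ hco) hc⟩
  · obtain ⟨k, rfl⟩ : 2 ∣ m := by omega
    have hodd : Odd k := Nat.odd_iff.mpr (by omega)
    have hM : Nat.Coprime 8 k := Nat.Coprime.pow_left 3 (Nat.coprime_two_left.mpr hodd)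
    obtain ⟨e, he, hek⟩ : ∃ e, (e = 1 ∨ e = 5) ∧ (e = 1 ↔ k % 4 = 1) := by
      by_cases hk : k % 4 = 1
      · exact ⟨1, by simp [hk]⟩
      · exact ⟨5, by simp [hk]⟩
    obtain ⟨p, -, hp, hp8, hpm⟩ := exists_prime_modEq_and_modEq (e := e) (by norm_num) (by omega) hM
      (by rcases he with rfl | rfl <;> norm_num) (cop k (by omega)) 0
    replace hp8 : p % 8 = e := by
      rw [hp8]; rcases he with rfl | rfl <;> rfl
    have hp4 : p % 4 = 1 := by omega
    have hpo : Odd p := Nat.odd_iff.mpr (by omega)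
    obtain ⟨a, b, hab⟩ := two_squares p hp hp4
    have hdvd : k ∣ p + 1 := by
      simpa using dvd_of (r := 1) hpm 1 (by rw [one_mul, Nat.sub_add_cancel (by omega)])
    refine ⟨p, a, b, hp.pos, hab.symm, hp.prime.irreducible.not_isSquare,
      (Nat.coprime_two_left.mpr hodd).mul_dvd_of_dvd_of_dvd (by omega) hdvd,
      exists_dvd_sq_sub_of_jacobiSym_eq_one hp ?_⟩
    push_cast
    rw [jacobiSym.mul_left, jacobiSym.quadratic_reciprocity_one_mod_four' hodd hp4,
      jacobiSym.mod_left' (a₁ := p) (a₂ := -1), jacobiSym.at_neg_one hodd, jacobiSym.at_two hpo]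
    · rw [ZMod.χ₈_nat_eq_if_mod_eight, ZMod.χ₄_nat_eq_if_mod_four,
        if_neg (show ¬ p % 2 = 0 by omega), if_neg (show ¬ k % 2 = 0 by omega)]
      by_cases hk : k % 4 = 1
      · rw [if_pos (by omega), if_pos hk, one_mul]
      · rw [if_neg (by omega), if_neg hk]; rfl
    · exact neg_one_of hdvd

/-! ### Between the field and the quadratic form -/

theorem exists_eq_add_mul_of_mem_imagQuadField {m : ℕ} {z : ℂ} (hz : z ∈ imagQuadField m) :
    ∃ a b : ℚ, z = a + b * (Complex.I * ((Real.sqrt (m : ℝ) : ℝ) : ℂ)) := by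
  have hw := imagQuadField_gen_sq m
  induction hz using IntermediateField.adjoin_induction with
  | mem x hx => exact ⟨0, 1, by simpa using hx⟩
  | algebraMap x => exact ⟨x, 0, by simp⟩
  | add x y _ _ hx hy =>
    obtain ⟨a, b, rfl⟩ := hx
    obtain ⟨c, d, rfl⟩ := hy
    exact ⟨a + c, b + d, by push_cast; ring⟩
  | mul x y _ _ hx hy =>
    obtain ⟨a, b, rfl⟩ := hx
    obtain ⟨c, d, rfl⟩ := hy
    exact ⟨a * c - m * b * d, a * d + b * c, by push_cast; linear_combination (b * d : ℂ) * hw⟩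
  | inv x _ hx =>
    obtain ⟨a, b, rfl⟩ := hx
    generalize Complex.I * ((Real.sqrt (m : ℝ) : ℝ) : ℂ) = w at *
    have hprod : ((a : ℂ) + b * w) * (a - b * w) = a ^ 2 + m * b ^ 2 := by
      linear_combination (-b ^ 2 : ℂ) * hw
    by_cases h0 : (a : ℂ) + b * w = 0
    · exact ⟨0, 0, by simp [h0]⟩
    · by_cases hn : a ^ 2 + m * b ^ 2 = 0
      · have ha : a = 0 := by
          have : 0 ≤ (m : ℚ) * b ^ 2 := by positivity
          nlinarith
        subst ha
        have hmb : (m : ℚ) * b ^ 2 = 0 := by linarith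
        have hsq : ((b : ℂ) * w) ^ 2 = 0 := by
          have : (m : ℂ) * b ^ 2 = 0 := by exact_mod_cast hmb
          linear_combination (b ^ 2 : ℂ) * hw - this
        exact absurd (by simpa using hsq) h0
      · have hnC : (a ^ 2 + m * b ^ 2 : ℂ) ≠ 0 := by exact_mod_cast hn
        refine ⟨a / (a ^ 2 + m * b ^ 2), -b / (a ^ 2 + m * b ^ 2), ?_⟩
        have hinv : ((a : ℂ) + b * w)⁻¹ = (a - b * w) / (a ^ 2 + m * b ^ 2) := by
          rw [eq_div_iff hnC, ← hprod, inv_mul_cancel_left₀ h0]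
        rw [hinv]
        push_cast
        ring

theorem exists_rat_of_sq_add_sq_eq_neg_one {m : ℕ} (hm : 0 < m)
    (h : ∃ r s : imagQuadField m, r ^ 2 + s ^ 2 = -1) :
    ∃ B x y z : ℚ, B ≠ 0 ∧ (m : ℚ) * B ^ 2 = x ^ 2 + y ^ 2 + z ^ 2 := by
  obtain ⟨⟨r, hr⟩, ⟨s, hs⟩, h⟩ := h
  obtain ⟨a, b, rfl⟩ := exists_eq_add_mul_of_mem_imagQuadField hr
  obtain ⟨c, d, rfl⟩ := exists_eq_add_mul_of_mem_imagQuadField hs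
  replace h := congrArg Subtype.val h
  simp only [IntermediateField.coe_add, IntermediateField.coe_pow, IntermediateField.coe_neg,
    IntermediateField.coe_one] at h
  have h' : ((a ^ 2 + c ^ 2 - m * (b ^ 2 + d ^ 2) + 1 : ℝ) : ℂ) +
      ((2 * (a * b + c * d) * Real.sqrt m : ℝ) : ℂ) * Complex.I = 0 := by
    push_cast
    linear_combination h - (b ^ 2 + d ^ 2 : ℂ) * imagQuadField_gen_sq m
  have hre := congrArg Complex.re h'
  have him := congrArg Complex.im h'
  simp only [Complex.add_re, Complex.add_im, Complex.ofReal_re, Complex.ofReal_im,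
    Complex.re_ofReal_mul, Complex.im_ofReal_mul, Complex.I_re, Complex.I_im, Complex.zero_re,
    Complex.zero_im, mul_zero, mul_one, add_zero, zero_add] at hre him
  have hsqrt : Real.sqrt m ≠ 0 := (Real.sqrt_pos.mpr (by exact_mod_cast hm)).ne'
  have hre' : a ^ 2 + c ^ 2 - m * (b ^ 2 + d ^ 2) + 1 = 0 := by exact_mod_cast hre
  have him' : a * b + c * d = 0 := by
    have := (mul_eq_zero.mp him).resolve_right hsqrt
    have h2 : (a * b + c * d : ℝ) = 0 := by linarith
    exact_mod_cast h2
  -- Multiply m(b² + d²) = a² + c² + 1 by b² + d² and use (a² + c²)(b² + d²) = (ab + cd)² + (ad -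
  -- bc)² with ab + cd = 0.
  refine ⟨b ^ 2 + d ^ 2, b, d, a * d - b * c, ?_, ?_⟩
  · intro h0
    rw [h0] at hre'
    nlinarith [sq_nonneg a, sq_nonneg c]
  · linear_combination (-(b ^ 2 + d ^ 2)) * hre' + (a * b + c * d) * him'

theorem exists_sq_add_sq_eq_neg_one_of_sum_two_squares {m : ℕ} (hm : 0 < m) {T X W a b : ℤ}
    (hT : T ≠ 0) (h : (m : ℤ) * T ^ 2 = X ^ 2 + (a ^ 2 + b ^ 2) * W ^ 2)
    (hab : a ^ 2 + b ^ 2 ≠ 0) :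
    ∃ r s : imagQuadField m, r ^ 2 + s ^ 2 = -1 := by
  let w : imagQuadField m := ⟨_, IntermediateField.mem_adjoin_simple_self ℚ
    (Complex.I * ((Real.sqrt (m : ℝ) : ℝ) : ℂ))⟩
  have hw : w ^ 2 = -(m : imagQuadField m) := by
    apply Subtype.ext
    simpa [w] using imagQuadField_gen_sq m
  have hK : (m : imagQuadField m) * T ^ 2 = X ^ 2 + (a ^ 2 + b ^ 2) * W ^ 2 := by
    exact_mod_cast congrArg (Int.cast : ℤ → imagQuadField m) h
  by_cases hW : W = 0
  · subst hW
    have hX : X ≠ 0 := by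
      rintro rfl
      have : (m : ℤ) * T ^ 2 ≠ 0 := by positivity
      exact this (by simpa using h)
    have hXK : (X : imagQuadField m) ≠ 0 := by exact_mod_cast hX
    refine ⟨T * w / X, 0, ?_⟩
    push_cast at hK
    field_simp
    linear_combination (T : imagQuadField m) ^ 2 * hw - hK
  · have hD : ((a ^ 2 + b ^ 2) * W : imagQuadField m) ≠ 0 := by
      exact_mod_cast mul_ne_zero hab hW
    -- Two-squares composition: the squares of the numerators sum to (a² + b²)(X² + (Tw)²) = -((a² +
    -- b²)W)².
    refine ⟨(a * X + b * (T * w)) / ((a ^ 2 + b ^ 2) * W),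
      (b * X - a * (T * w)) / ((a ^ 2 + b ^ 2) * W), ?_⟩
    rw [div_pow, div_pow, ← add_div, div_eq_iff (pow_ne_zero 2 hD)]
    linear_combination (a ^ 2 + b ^ 2 : imagQuadField m) * T ^ 2 * hw
      - (a ^ 2 + b ^ 2 : imagQuadField m) * hK

theorem theorem2p8 (m : ℕ) (hm_pos : 0 < m) (hm : Squarefree m) :
    ((∃ r s : imagQuadField m, r ^ 2 + s ^ 2 = -1 ∧ r * s * (r ^ 2 - s ^ 2) ≠ 0) ↔
      ¬ m ≡ 7 [MOD 8]) ∧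
    ((∃ t u : imagQuadField m, t ^ 2 + u ^ 2 = -2 ∧ t * u * (t ^ 2 - u ^ 2) ≠ 0) ↔
      ¬ m ≡ 7 [MOD 8]) := by
  rw [nondegenerate_sq_add_sq_eq_neg_two_iff, and_self]
  constructor
  · rintro ⟨r, s, h, -⟩ h7
    obtain ⟨B, x, y, z, hB, hxyz⟩ := exists_rat_of_sq_add_sq_eq_neg_one hm_pos ⟨r, s, h⟩
    exact hB (eq_zero_of_mul_rat_sq_eq_three_squares h7 B x y z hxyz)
  · intro h7
    have hm4 : ¬ 4 ∣ m := fun h => by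
      simpa using Nat.isUnit_iff.mp (hm 2 h)
    obtain ⟨N, a, b, hN, hab, hsq, hdvd, c, hc⟩ := exists_sum_two_squares_and_residues hm4 h7
    have hcop : Nat.Coprime m N := Nat.dvd_one.mp <|
      (Nat.dvd_add_right (Nat.gcd_dvd_right m N)).mp ((Nat.gcd_dvd_left m N).trans hdvd)
    obtain ⟨T, X, W, hT, h⟩ := exists_mul_sq_eq_sq_add_mul_sq m N hm_pos hN hsq hcop c 1 hc
      (by rw [one_pow, add_comm]; exact_mod_cast hdvd)
    have habZ : (N : ℤ) = (a : ℤ) ^ 2 + (b : ℤ) ^ 2 := by exact_mod_cast hab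
    rw [habZ] at h
    exact exists_nondegenerate_of_sq_add_sq_eq_neg_one
      (exists_sq_add_sq_eq_neg_one_of_sum_two_squares hm_pos hT h
        (by rw [← habZ]; exact_mod_cast hN.ne'))
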